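/- Let $n\ge 1$ and let $A=(a_{i,j})\in\mathbb R^{n\times n}$ be an irreducible L-matrix with unit diagonal, i.e. $a_{i,i}=1$ for all $i$, $a_{i,j}\le 0$ for $i\ne j$, and no simultaneous permutation of rows and columns brings $A$ to the form $\begin{pmatrix}B_{1,1}&B_{1,2}\\0&B_{2,2}\end{pmatrix}$ with square diagonal blocks of orders $r$ and $n-r$, $1\le r\le n-1$. Let $0<\omega\le 1$ and $0\le\gamma\le 1$. For a square matrix $B=D-L-U$ with $D$ diagonal, $L$ strictly lower and $U$ strictly upper triangular, let $$\mathscr L_{\gamma,\omega}(B)=(D-\gamma L)^{-1}\big[(1-\omega)D+(\omega-\gamma)L+\omega U\big]$$ be its AOR iteration matrix, and let $\rho(\cdot)$ denote the spectral radius. Let $\alpha_{i,j}\ge 0$ for $1\le j<i\le n$ with $\sum_{i=2}^n\sum_{j=1}^{i-1}\alpha_{i,j}a_{i,j}\neq 0$ (so $n\ge2$), let $Q_3$ be the strictly lower triangular matrix with entries $-\alpha_{i,j}a_{i,j}$ for $i>j$, and put $A^{(3)}=(I+Q_3)A$. Suppose that $\sum_{k=1}^{i-1}\alpha_{i,k}a_{i,k}a_{k,i}<1$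 for $i=2,\dots,n$. For $j<i$ write $$e_{i,j}=(1-\alpha_{i,j})a_{i,j}-\sum_{1\le k\le i-1,\;k\ne j}\alpha_{i,k}a_{i,k}a_{k,j}.$$ Consider the condition (3.19) for all $j<i$ with $a_{i,j}<0$: $e_{i,j}\le 0$ if $A^{(3)}$ is irreducible, and $e_{i,j}<0$ if $A^{(3)}$ is reducible. Suppose that one of the following holds: (i) $\gamma<1$ and (3.19) holds. (ii) $\gamma=1$, (3.19) holds, and one of the following holds: ($ii_1$) there are $i\in\{2,\dots,n\}$, $j\in\{2,\dots,i\}$, $k\in\{1,\dots,j-1\}$ with $\alpha_{i,k}a_{i,k}a_{k,j}>0$; ($ii_2$) $a_{n,1}<0$ and $\alpha_{n,1}>0$; ($ii_3$) $a_{k,k+1}<0$ for $k=1,\dots,n-1$. (iii) $\gamma=1$; $e_{i,j}\le 0$ for all $j<i$; for each $i\in\{2,\dots,n-1\}$ there are $j\in\{2,\dots,i\}$ and $k\in\{1,\dots,j-1\}$ with $\alpha_{i,k}a_{i,k}a_{k,j}>0$; and one of the following holds: ($iii_1$) there are $j\in\{2,\dots,n\}$ and $k\in\{1,\dots,j-1\}$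 with $\alpha_{n,k}a_{n,k}a_{k,j}>0$; ($iii_2$) $a_{n,1}<0$ and $\alpha_{n,1}>0$; ($iii_3$) there is $j\in\{2,\dots,n-1\}$ with $e_{n,j}<0$. Then exactly one of the following mutually exclusive relations holds: (a) $\rho(\mathscr L_{\gamma,\omega}(A^{(3)}))<\rho(\mathscr L_{\gamma,\omega}(A))<1$; (b) $\rho(\mathscr L_{\gamma,\omega}(A^{(3)}))=\rho(\mathscr L_{\gamma,\omega}(A))=1$; (c) $\rho(\mathscr L_{\gamma,\omega}(A^{(3)}))>\rho(\mathscr L_{\gamma,\omega}(A))>1$. -/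

import Mathlib

/-- A Z-matrix: all off-diagonal entries are nonpositive. -/
def IsZMatrix {n : ℕ} (B : Matrix (Fin n) (Fin n) ℝ) : Prop :=
  ∀ i j, i ≠ j → B i j ≤ 0

/-- An L-matrix: a Z-matrix with positive diagonal entries. -/
def IsLMatrix {n : ℕ} (B : Matrix (Fin n) (Fin n) ℝ) : Prop :=
  IsZMatrix B ∧ ∀ i, 0 < B i i

/-- `B` is reducible if a simultaneous permutation of its rows and columns (that is, `V B Vᵀ` for a
permutation matrix `V`) is block upper triangular with diagonal blocks of sizes `r` and `n - r`,
where `1 ≤ r ≤ n - 1`. -/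
def IsReducibleMatrix {n : ℕ} (B : Matrix (Fin n) (Fin n) ℝ) : Prop :=
  ∃ (σ : Equiv.Perm (Fin n)) (r : ℕ), 1 ≤ r ∧ r < n ∧
    ∀ i j : Fin n, r ≤ i.val → j.val < r → (B.submatrix σ σ) i j = 0

/-- `B` is irreducible if it is not reducible. -/
def IsIrreducibleMatrix {n : ℕ} (B : Matrix (Fin n) (Fin n) ℝ) : Prop :=
  ¬ IsReducibleMatrix B

/-- The diagonal matrix `D` in the decomposition `B = D - L - U`. -/
def diagPart {n : ℕ} (B : Matrix (Fin n) (Fin n) ℝ) : Matrix (Fin n) (Fin n) ℝ :=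
  Matrix.diagonal fun i => B i i

/-- The strictly lower triangular matrix `L` in the decomposition `B = D - L - U`. -/
def lowerPart {n : ℕ} (B : Matrix (Fin n) (Fin n) ℝ) : Matrix (Fin n) (Fin n) ℝ :=
  Matrix.of fun i j => if j < i then -B i j else 0

/-- The strictly upper triangular matrix `U` in the decomposition `B = D - L - U`. -/
def upperPart {n : ℕ} (B : Matrix (Fin n) (Fin n) ℝ) : Matrix (Fin n) (Fin n) ℝ :=
  Matrix.of fun i j => if i < j then -B i j else 0

/-- The AOR iteration matrix `(D - γ L)⁻¹ ((1 - ω) D + (ω - γ) L + ω U)` of `B = D - L - U`. -/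
noncomputable def aorMatrix {n : ℕ} (B : Matrix (Fin n) (Fin n) ℝ) (γ ω : ℝ) :
    Matrix (Fin n) (Fin n) ℝ :=
  (diagPart B - γ • lowerPart B)⁻¹ *
    ((1 - ω) • diagPart B + (ω - γ) • lowerPart B + ω • upperPart B)

/-- The spectral radius of a real matrix: the largest modulus of its complex eigenvalues. -/
noncomputable def specRadius {n : ℕ} (B : Matrix (Fin n) (Fin n) ℝ) : ENNReal :=
  spectralRadius ℂ (B.map Complex.ofReal)

/-- The lower triangular matrix `Q` with entries `-α i j * A i j` for `j < i`, zero otherwise. -/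
def lowerQ {n : ℕ} (A α : Matrix (Fin n) (Fin n) ℝ) : Matrix (Fin n) (Fin n) ℝ :=
  Matrix.of fun i j => if j < i then -(α i j * A i j) else 0

/-- The preconditioned matrix `P A` with `P = I + Q`. -/
def preconditioned {n : ℕ} (A α : Matrix (Fin n) (Fin n) ℝ) : Matrix (Fin n) (Fin n) ℝ :=
  (1 + lowerQ A α) * A

/-- The quantity `(1 - α i j) a i j - ∑_{k < i, k ≠ j} α i k * a i k * a k j`. -/
def lowerExpr {n : ℕ} (A α : Matrix (Fin n) (Fin n) ℝ) (i j : Fin n) : ℝ :=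
  (1 - α i j) * A i j - ∑ k ∈ (Finset.Iio i).erase j, α i k * A i k * A k j

/-- The relation `x ≲ 0`, relative to the matrix `B`: it means `x ≤ 0` if `B` is irreducible, and
`x < 0` otherwise. -/
def LesssimZero {n : ℕ} (B : Matrix (Fin n) (Fin n) ℝ) (x : ℝ) : Prop :=
  (IsIrreducibleMatrix B → x ≤ 0) ∧ (¬ IsIrreducibleMatrix B → x < 0)

/-- Exactly one of the three relations `ρ' < ρ < 1`, `ρ' = ρ = 1`, `ρ' > ρ > 1` holds. -/
def SteinRosenbergStrict (ρ' ρ : ENNReal) : Prop :=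
  ((ρ' < ρ ∧ ρ < 1) ∨ (ρ' = ρ ∧ ρ = 1) ∨ (ρ' > ρ ∧ ρ > 1)) ∧
  ¬ ((ρ' < ρ ∧ ρ < 1) ∧ (ρ' = ρ ∧ ρ = 1)) ∧
  ¬ ((ρ' < ρ ∧ ρ < 1) ∧ (ρ' > ρ ∧ ρ > 1)) ∧
  ¬ ((ρ' = ρ ∧ ρ = 1) ∧ (ρ' > ρ ∧ ρ > 1))

/-! Write `G = D - γL`. The AOR matrix of `B` is `G⁻¹(G - ωB)`, so an eigenpair `(τ, x)` of it is a
solution of `ωBx = (1 - τ)Gx`, with no inverse left. For an L-matrix `G⁻¹` and the AOR matrix are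
nonnegative, and Perron–Frobenius realises the spectral radius as an eigenvalue with a nonnegative
eigenvector, on either side.

Let `A' = PA` with `P = I + Q`, and let `G'` be its left splitting factor. Take a right Perron pair
`(τ, x)` for `A`, where irreducibility gives `x > 0`, and a left one `(τ', q)` for `A'`, normalised
so that `ω qA' = (1 - τ') qG'`. With the defect `F = PG - G'`, evaluating `ω qA'x` in two ways gives
`(1 - τ') qG'x = (1 - τ)(qG'x + qFx)`. Here `qG'x > 0`, and `F ≥ 0` entrywise, so `τ - τ'` has the
sign of `1 - τ` as soon as `qFx > 0`. This is the trichotomy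
(`steinRosenbergStrict_of_splittingDefect`).

It remains to see that `q` charges a nonzero row of `F`. If `τ' > 1 - ω`, the support of `q` is
closed under the nonzero entries of `A'`, so every nonempty closed set has to meet a nonzero row of
`F`. In cases (i) and (ii) `A'` is irreducible, the only nonempty closed set is everything, and one
positive entry of `F` is enough. In case (iii) `A'` may be reducible, and the row conditions supply
a suitable row in each closed set. -/

/-! ### Perron–Frobenius theory for nonnegative matrices -/

open Matrix in
/-- A Collatz–Wielandt lower bound of a matrix is at most the sum of the moduli of its entries. -/
theorem collatzWielandt_le_sum_abs {ι : Type*} [Fintype ι] {T : Matrix ι ι ℝ} {x : ι → ℝ} {c : ℝ}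
    (hx : x ∈ stdSimplex ℝ ι) (h : ∀ i, c * x i ≤ (T *ᵥ x) i) : c ≤ ∑ i, ∑ j, |T i j| := by
  calc c = ∑ i, c * x i := by rw [← Finset.mul_sum, hx.2, mul_one]
    _ ≤ ∑ i, (T *ᵥ x) i := Finset.sum_le_sum fun i _ => h i
    _ ≤ ∑ i, ∑ j, |T i j| := by
      refine Finset.sum_le_sum fun i _ => Finset.sum_le_sum fun j _ => ?_
      have h1 : x j ≤ 1 := by
        rw [← hx.2]
        exact Finset.single_le_sum (fun k _ => hx.1 k) (Finset.mem_univ j)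
      calc T i j * x j ≤ |T i j| * x j := mul_le_mul_of_nonneg_right (le_abs_self _) (hx.1 j)
        _ ≤ |T i j| * 1 := mul_le_mul_of_nonneg_left h1 (abs_nonneg _)
        _ = |T i j| := mul_one _

/-- A nonzero nonnegative vector can be scaled into the standard simplex. -/
theorem exists_smul_mem_stdSimplex {ι : Type*} [Fintype ι] {w : ι → ℝ} (hw : ∀ i, 0 ≤ w i)
    (hw0 : w ≠ 0) : ∃ t : ℝ, 0 < t ∧ t • w ∈ stdSimplex ℝ ι := by
  have hs : 0 < ∑ i, w i := by
    obtain ⟨i, hi⟩ := Function.ne_iff.1 hw0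
    exact Finset.sum_pos' (fun i _ => hw i) ⟨i, Finset.mem_univ i, lt_of_le_of_ne (hw i) (Ne.symm hi)⟩
  refine ⟨(∑ i, w i)⁻¹, inv_pos.2 hs, fun i => mul_nonneg (inv_pos.2 hs).le (hw i), ?_⟩
  simp only [Pi.smul_apply, smul_eq_mul, ← Finset.mul_sum]
  exact inv_mul_cancel₀ hs.ne'

open Matrix in
/-- An entrywise positive matrix has an eigenvector in the standard simplex whose eigenvalue is the
largest Collatz–Wielandt lower bound. -/
theorem exists_eigenvector_of_pos {ι : Type*} [Fintype ι] [Nonempty ι] {T : Matrix ι ι ℝ}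
    (hT : ∀ i j, 0 < T i j) :
    ∃ (c : ℝ) (x : ι → ℝ), 0 ≤ c ∧ x ∈ stdSimplex ℝ ι ∧ T *ᵥ x = c • x ∧
      ∀ (a : ℝ) (w : ι → ℝ), (∀ i, 0 ≤ w i) → w ≠ 0 → (∀ i, a * w i ≤ (T *ᵥ w) i) → a ≤ c := by
  classical
  set C : ℝ := ∑ i, ∑ j, |T i j| with hC
  have hC0 : 0 ≤ C := Finset.sum_nonneg fun i _ => Finset.sum_nonneg fun j _ => abs_nonneg _
  -- Pairs of a Collatz–Wielandt bound and a normalised vector attaining it. The bound `C` makes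
  -- this set compact, so a largest bound exists.
  set K : Set (ℝ × (ι → ℝ)) :=
    (Set.Icc 0 C ×ˢ stdSimplex ℝ ι) ∩ {p | ∀ i, p.1 * p.2 i ≤ (T *ᵥ p.2) i} with hK
  have hclosed : IsClosed {p : ℝ × (ι → ℝ) | ∀ i, p.1 * p.2 i ≤ (T *ᵥ p.2) i} := by
    simp only [Set.ofPred_forall]
    refine isClosed_iInter fun i => isClosed_le (by fun_prop) ?_
    simp only [Matrix.mulVec, dotProduct]
    fun_prop
  have hcompact : IsCompact K := (isCompact_Icc.prod (isCompact_stdSimplex ℝ ι)).inter_right hclosed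
  have hmv : ∀ w : ι → ℝ, (∀ i, 0 ≤ w i) → ∀ i, 0 ≤ (T *ᵥ w) i := fun w hw i =>
    Finset.sum_nonneg fun j _ => mul_nonneg (hT i j).le (hw j)
  have hmvpos : ∀ w : ι → ℝ, (∀ i, 0 ≤ w i) → w ≠ 0 → ∀ i, 0 < (T *ᵥ w) i := by
    intro w hw hw0 i
    obtain ⟨j, hj⟩ := Function.ne_iff.1 hw0
    exact Finset.sum_pos' (fun j _ => mul_nonneg (hT i j).le (hw j))
      ⟨j, Finset.mem_univ j, mul_pos (hT i j) (lt_of_le_of_ne (hw j) (Ne.symm hj))⟩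
  obtain ⟨i₀⟩ := ‹Nonempty ι›
  have hne : K.Nonempty := by
    have h1 := single_mem_stdSimplex ℝ i₀
    refine ⟨(0, Pi.single i₀ 1), ⟨⟨⟨le_rfl, hC0⟩, h1⟩, fun i => ?_⟩⟩
    simpa using hmv _ h1.1 i
  obtain ⟨⟨c, x⟩, ⟨⟨hc, hx⟩, hcx⟩, hmax⟩ := hcompact.exists_isMaxOn hne continuous_fst.continuousOn
  simp only [Set.mem_ofPred_eq] at hc hx hcx
  have hmax' : ∀ (a : ℝ) (w : ι → ℝ), (∀ i, 0 ≤ w i) → w ≠ 0 →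
      (∀ i, a * w i ≤ (T *ᵥ w) i) → a ≤ c := by
    intro a w hw hw0 haw
    rcases lt_or_ge a 0 with ha | ha
    · exact ha.le.trans hc.1
    obtain ⟨t, ht, htw⟩ := exists_smul_mem_stdSimplex hw hw0
    have h1 : ∀ i, a * (t • w) i ≤ (T *ᵥ (t • w)) i := by
      intro i
      rw [Matrix.mulVec_smul]
      simp only [Pi.smul_apply, smul_eq_mul]
      nlinarith [mul_le_mul_of_nonneg_left (haw i) ht.le]
    exact hmax (show ((a, t • w) : ℝ × (ι → ℝ)) ∈ K from
      ⟨⟨⟨ha, collatzWielandt_le_sum_abs htw h1⟩, htw⟩, h1⟩)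
  have hx0 : x ≠ 0 := by
    rintro rfl
    simpa using hx.2
  refine ⟨c, x, hc.1, hx, ?_, hmax'⟩
  by_contra hneq
  set d : ι → ℝ := T *ᵥ x - c • x with hd
  have hd0 : d ≠ 0 := sub_ne_zero.2 hneq
  have hdn : ∀ i, 0 ≤ d i := fun i => sub_nonneg.2 (hcx i)
  set y : ι → ℝ := T *ᵥ x with hy
  have hypos := hmvpos x hx.1 hx0
  have hTd := hmvpos d hdn hd0
  have hTd' : T *ᵥ d = T *ᵥ y - c • y := by
    rw [hd, Matrix.mulVec_sub, Matrix.mulVec_smul]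
  obtain ⟨k, -, hk⟩ := Finset.exists_min_image Finset.univ (fun i => (T *ᵥ d) i / y i)
    ⟨i₀, Finset.mem_univ _⟩
  set ε := (T *ᵥ d) k / y k with hε
  have hεpos : 0 < ε := div_pos (hTd k) (hypos k)
  have := hmax' (c + ε) y (fun i => (hypos i).le) (fun h => (hypos i₀).ne' (congrFun h i₀)) (by
    intro i
    have h1 := hk i (Finset.mem_univ i)
    rw [le_div_iff₀ (hypos i)] at h1
    have h2 : (T *ᵥ d) i = (T *ᵥ y) i - c * y i := by rw [hTd']; rfl
    linarith)
  linarith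

open Matrix Filter Topology in
/-- An entrywise nonnegative matrix has a nonnegative eigenvector whose eigenvalue is the largest
Collatz–Wielandt lower bound. -/
theorem exists_eigenvector_of_nonneg {ι : Type*} [Fintype ι] [Nonempty ι] {T : Matrix ι ι ℝ}
    (hT : ∀ i j, 0 ≤ T i j) :
    ∃ (c : ℝ) (x : ι → ℝ), 0 ≤ c ∧ x ∈ stdSimplex ℝ ι ∧ T *ᵥ x = c • x ∧
      ∀ (a : ℝ) (w : ι → ℝ), (∀ i, 0 ≤ w i) → w ≠ 0 → (∀ i, a * w i ≤ (T *ᵥ w) i) → a ≤ c := by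
  -- The positive case is applied to `T` with `E k` added to each entry; eigenpairs stay in a
  -- compact set, and a subsequence converges.
  set E : ℕ → ℝ := fun k => 1 / ((k : ℝ) + 1) with hE
  have hEpos : ∀ k, 0 < E k := fun k => Nat.one_div_pos_of_nat
  have hEle : ∀ k, E k ≤ 1 := fun k => by
    rw [hE]; simp only
    rw [div_le_one (by positivity)]
    linarith [(Nat.cast_nonneg k : (0 : ℝ) ≤ k)]
  have hElim : Tendsto E atTop (𝓝 0) := tendsto_one_div_add_atTop_nhds_zero_nat
  set S : ℕ → Matrix ι ι ℝ := fun k => of fun i j => T i j + E k with hS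
  choose c x hc hx hcx hmax using fun k => exists_eigenvector_of_pos (T := S k)
    (fun i j => add_pos_of_nonneg_of_pos (hT i j) (hEpos k))
  set C : ℝ := ∑ i, ∑ j, (|T i j| + 1) with hC
  have hcC : ∀ k, c k ≤ C := by
    intro k
    refine (collatzWielandt_le_sum_abs (hx k) fun i => (congrFun (hcx k) i).ge).trans ?_
    refine Finset.sum_le_sum fun i _ => Finset.sum_le_sum fun j _ => ?_
    calc |T i j + E k| ≤ |T i j| + |E k| := abs_add_le _ _
      _ ≤ |T i j| + 1 := by rw [abs_of_pos (hEpos k)]; linarith [hEle k]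
  obtain ⟨⟨c', x'⟩, ⟨hc', hx'⟩, φ, hφ, hlim⟩ :=
    (isCompact_Icc.prod (isCompact_stdSimplex ℝ ι)).tendsto_subseq
      (x := fun k => (c k, x k)) (fun k => ⟨⟨hc k, hcC k⟩, hx k⟩)
  have hlc : Tendsto (fun k => c (φ k)) atTop (𝓝 c') := (continuous_fst.tendsto _).comp hlim
  have hlx : Tendsto (fun k => x (φ k)) atTop (𝓝 x') := (continuous_snd.tendsto _).comp hlim
  have hlxi : ∀ i, Tendsto (fun k => x (φ k) i) atTop (𝓝 (x' i)) := fun i =>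
    ((continuous_apply i).tendsto _).comp hlx
  have hlE : Tendsto (fun k => E (φ k)) atTop (𝓝 0) := hElim.comp hφ.tendsto_atTop
  refine ⟨c', x', hc'.1, hx', ?_, ?_⟩
  · ext i
    have h1 : Tendsto (fun k => (S (φ k) *ᵥ x (φ k)) i) atTop (𝓝 ((T *ᵥ x') i)) := by
      simp only [Matrix.mulVec, dotProduct]
      refine tendsto_finsetSum _ fun j _ => Tendsto.mul ?_ (hlxi j)
      simpa [hS] using (tendsto_const_nhds (x := T i j)).add hlE
    have h2 : Tendsto (fun k => (S (φ k) *ᵥ x (φ k)) i) atTop (𝓝 ((c' • x') i)) := by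
      refine (hlc.mul (hlxi i)).congr fun k => ?_
      rw [hcx]; rfl
    exact tendsto_nhds_unique h1 h2
  · intro a w hw hw0 haw
    -- Increasing the entries preserves lower bounds, so `a` is at most every perturbed eigenvalue
    -- and hence at most their limit.
    refine ge_of_tendsto' hlc fun k => hmax (φ k) a w hw hw0 fun i => (haw i).trans ?_
    refine Finset.sum_le_sum fun j _ => mul_le_mul_of_nonneg_right ?_ (hw j)
    simpa [hS] using (hEpos (φ k)).le

open Matrix in
/-- A scalar is in the spectrum of a matrix over a field iff it has an eigenvector. -/
theorem mem_spectrum_iff_exists_mulVec {ι 𝕜 : Type*} [Field 𝕜] [Fintype ι] [DecidableEq ι]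
    {T : Matrix ι ι 𝕜} {μ : 𝕜} : μ ∈ spectrum 𝕜 T ↔ ∃ v, v ≠ 0 ∧ T *ᵥ v = μ • v := by
  rw [spectrum.mem_iff, Matrix.isUnit_iff_isUnit_det, isUnit_iff_ne_zero, not_not,
    ← Matrix.exists_mulVec_eq_zero_iff]
  refine exists_congr fun v => and_congr_right fun _ => ?_
  rw [Matrix.sub_mulVec, sub_eq_zero, eq_comm, Algebra.algebraMap_eq_smul_one,
    Matrix.smul_mulVec, Matrix.one_mulVec]

open Matrix in
/-- Perron–Frobenius: the spectral radius of a nonnegative matrix is an eigenvalue with a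
nonnegative eigenvector, and it is the largest Collatz–Wielandt lower bound. -/
theorem exists_eigenvector_specRadius {n : ℕ} [NeZero n] {T : Matrix (Fin n) (Fin n) ℝ}
    (hT : ∀ i j, 0 ≤ T i j) :
    ∃ (c : ℝ) (x : Fin n → ℝ), 0 ≤ c ∧ (∀ i, 0 ≤ x i) ∧ x ≠ 0 ∧ T *ᵥ x = c • x ∧
      specRadius T = ENNReal.ofReal c ∧
      ∀ (a : ℝ) (w : Fin n → ℝ), (∀ i, 0 ≤ w i) → w ≠ 0 → (∀ i, a * w i ≤ (T *ᵥ w) i) → a ≤ c := by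
  obtain ⟨c, x, hc, hx, hcx, hmax⟩ := exists_eigenvector_of_nonneg hT
  have hx0 : x ≠ 0 := by
    rintro rfl
    simpa using hx.2
  refine ⟨c, x, hc, hx.1, hx0, hcx, le_antisymm ?_ ?_, hmax⟩
  · refine iSup₂_le fun μ hμ => ?_
    obtain ⟨v, hv0, hv⟩ := mem_spectrum_iff_exists_mulVec.1 hμ
    rw [← enorm_eq_nnnorm, ← ofReal_norm]
    -- By the triangle inequality, the moduli of a complex eigenvector satisfy `|μ||v| ≤ T|v|`.
    refine ENNReal.ofReal_le_ofReal (hmax ‖μ‖ (fun i => ‖v i‖) (fun i => norm_nonneg _) ?_ ?_)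
    · intro h
      exact hv0 (funext fun i => norm_eq_zero.1 (congrFun h i))
    · intro i
      calc ‖μ‖ * ‖v i‖ = ‖(T.map Complex.ofReal *ᵥ v) i‖ := by
            rw [hv, ← norm_mul]; rfl
        _ ≤ ∑ j, ‖T.map Complex.ofReal i j * v j‖ := by
            simp only [Matrix.mulVec, dotProduct]
            exact norm_sum_le _ _
        _ = ∑ j, T i j * ‖v j‖ := by
            refine Finset.sum_congr rfl fun j _ => ?_
            rw [norm_mul, Matrix.map_apply, Complex.norm_real, Real.norm_of_nonneg (hT i j)]
  · have hmem : (c : ℂ) ∈ spectrum ℂ (T.map Complex.ofReal) := by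
      refine mem_spectrum_iff_exists_mulVec.2 ⟨fun i => (x i : ℂ), fun h => hx0 ?_, ?_⟩
      · exact funext fun i => Complex.ofReal_eq_zero.1 (congrFun h i)
      · ext i
        have := congrArg Complex.ofReal (congrFun hcx i)
        simpa [Matrix.mulVec, dotProduct] using this
    refine le_trans (le_of_eq ?_)
      (le_iSup₂ (f := fun (k : ℂ) (_ : k ∈ spectrum ℂ (T.map Complex.ofReal)) => (‖k‖₊ : ENNReal))
        (c : ℂ) hmem)
    rw [← enorm_eq_nnnorm, ← ofReal_norm, Complex.norm_real, Real.norm_of_nonneg hc]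

open Matrix in
theorem specRadius_transpose {n : ℕ} (T : Matrix (Fin n) (Fin n) ℝ) :
    specRadius Tᵀ = specRadius T := by
  have : spectrum ℂ (Tᵀ.map Complex.ofReal) = spectrum ℂ (T.map Complex.ofReal) := by
    ext μ
    rw [spectrum.mem_iff, spectrum.mem_iff, ← Matrix.isUnit_transpose]
    rw [Matrix.transpose_sub, Matrix.transpose_map, Matrix.transpose_transpose,
      Matrix.algebraMap_eq_diagonal, Matrix.diagonal_transpose]
  simp only [specRadius, spectralRadius, this]

/-! ### Irreducibility and closed sets of indices -/

/-- An irreducible matrix has no proper nonempty set of indices closed under its nonzero entries. -/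
theorem IsIrreducibleMatrix.mem_of_closed {n : ℕ} {B : Matrix (Fin n) (Fin n) ℝ}
    (hB : IsIrreducibleMatrix B) {K : Set (Fin n)} (hne : K.Nonempty)
    (hK : ∀ i ∈ K, ∀ j, B i j ≠ 0 → j ∈ K) (i : Fin n) : i ∈ K := by
  classical
  by_contra hi
  refine hB ?_
  -- The permutation lists the complement of `K` first: rows in `K` then vanish on the first `r`
  -- columns, which is the zero block.
  set r := Fintype.card {j // j ∉ K} with hr
  have hrn : r < n := by
    obtain ⟨k, hk⟩ := hne
    exact (Fintype.card_subtype_lt (p := fun j => j ∉ K) (x := k) (not_not.2 hk)).trans_eq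
      (Fintype.card_fin n)
  have hr1 : 1 ≤ r := Fintype.card_pos_iff.2 ⟨⟨i, hi⟩⟩
  have hcard : Fintype.card {j : Fin n // j.val < r} = Fintype.card {j // j ∉ K} := by
    rw [← hr, Fintype.card_subtype, Fin.card_filter_val_lt, min_eq_right hrn.le]
  set e := Fintype.equivOfCardEq hcard
  refine ⟨e.extendSubtype, r, hr1, hrn, fun a b ha hb => ?_⟩
  have h1 : e.extendSubtype b ∉ K := e.extendSubtype_mem b hb
  have h2 : e.extendSubtype a ∈ K := not_not.1 (e.extendSubtype_not_mem a (not_lt.2 ha))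
  by_contra h
  exact h1 (hK _ h2 _ h)

theorem IsIrreducibleMatrix.exists_ne_zero {n : ℕ} [Nontrivial (Fin n)]
    {B : Matrix (Fin n) (Fin n) ℝ} (hB : IsIrreducibleMatrix B) (i : Fin n) :
    ∃ j, j ≠ i ∧ B i j ≠ 0 := by
  by_contra! h
  obtain ⟨k, hk⟩ := exists_ne i
  refine hk (hB.mem_of_closed (K := {i}) ⟨i, rfl⟩ ?_ k)
  rintro _ rfl j hj
  by_contra hji
  exact hj (h j hji)

/-- A matrix with at least the nonzero entries of an irreducible one is irreducible. -/
theorem IsIrreducibleMatrix.mono {n : ℕ} {B C : Matrix (Fin n) (Fin n) ℝ}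
    (hB : IsIrreducibleMatrix B) (h : ∀ i j, i ≠ j → C i j = 0 → B i j = 0) :
    IsIrreducibleMatrix C := by
  rintro ⟨σ, r, h1, h2, h3⟩
  refine hB ⟨σ, r, h1, h2, fun i j hi hj => h _ _ ?_ (h3 i j hi hj)⟩
  intro he
  have := σ.injective he
  omega

/-! ### The AOR splitting and monotonicity of its left factor -/

/-- The weights `1`, `γ`, `0` on, below and above the diagonal. -/
noncomputable def aorWeight {n : ℕ} (γ : ℝ) (i j : Fin n) : ℝ :=
  if i = j then 1 else if j < i then γ else 0

/-- The matrix `D - γ L` of the decomposition `B = D - L - U`. -/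
noncomputable def aorLeft {n : ℕ} (B : Matrix (Fin n) (Fin n) ℝ) (γ : ℝ) :
    Matrix (Fin n) (Fin n) ℝ :=
  Matrix.of fun i j => aorWeight γ i j * B i j

@[simp] theorem aorLeft_apply {n : ℕ} (B : Matrix (Fin n) (Fin n) ℝ) (γ : ℝ) (i j : Fin n) :
    aorLeft B γ i j = aorWeight γ i j * B i j := rfl

@[simp] theorem aorWeight_self {n : ℕ} (γ : ℝ) (i : Fin n) : aorWeight γ i i = 1 := if_pos rfl

theorem aorWeight_of_lt {n : ℕ} (γ : ℝ) {i j : Fin n} (h : i < j) : aorWeight γ i j = 0 := by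
  rw [aorWeight, if_neg h.ne, if_neg h.not_gt]

theorem aorWeight_of_gt {n : ℕ} (γ : ℝ) {i j : Fin n} (h : j < i) : aorWeight γ i j = γ := by
  rw [aorWeight, if_neg h.ne', if_pos h]

theorem aorWeight_nonneg {n : ℕ} {γ : ℝ} (hγ : 0 ≤ γ) (i j : Fin n) : 0 ≤ aorWeight γ i j := by
  unfold aorWeight; split_ifs <;> linarith

theorem aorWeight_le_one {n : ℕ} {γ : ℝ} (hγ : γ ≤ 1) (i j : Fin n) : aorWeight γ i j ≤ 1 := by
  unfold aorWeight; split_ifs <;> linarith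

theorem diagPart_sub_smul_lowerPart {n : ℕ} (B : Matrix (Fin n) (Fin n) ℝ) (γ : ℝ) :
    diagPart B - γ • lowerPart B = aorLeft B γ := by
  ext i j
  rcases lt_trichotomy i j with h | rfl | h
  · simp [diagPart, lowerPart, aorWeight_of_lt γ h, h.ne, h.not_gt]
  · simp [diagPart, lowerPart]
  · simp [diagPart, lowerPart, aorWeight_of_gt γ h, h.ne', h]

theorem aorMatrix_eq {n : ℕ} (B : Matrix (Fin n) (Fin n) ℝ) (γ ω : ℝ) :
    aorMatrix B γ ω = (aorLeft B γ)⁻¹ * (aorLeft B γ - ω • B) := by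
  rw [aorMatrix, diagPart_sub_smul_lowerPart]
  congr 1
  ext i j
  rcases lt_trichotomy i j with h | rfl | h
  · simp [diagPart, lowerPart, upperPart, aorWeight_of_lt γ h, h.ne, h.not_gt, h]
  · simp [diagPart, lowerPart, upperPart]; ring
  · simp [diagPart, lowerPart, upperPart, aorWeight_of_gt γ h, h.ne', h, h.not_gt]; ring

theorem isLMatrix_aorLeft {n : ℕ} {B : Matrix (Fin n) (Fin n) ℝ} {γ : ℝ} (hB : IsLMatrix B)
    (hγ : 0 ≤ γ) : IsLMatrix (aorLeft B γ) :=
  ⟨fun i j h => mul_nonpos_of_nonneg_of_nonpos (aorWeight_nonneg hγ i j) (hB.1 i j h),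
    fun i => by simpa using hB.2 i⟩

theorem isLowerTriangular_aorLeft {n : ℕ} (B : Matrix (Fin n) (Fin n) ℝ) (γ : ℝ) :
    (aorLeft B γ).IsLowerTriangular := by
  intro i j h
  have hij : i < j := h
  rw [aorLeft_apply, aorWeight_of_lt γ hij, zero_mul]

theorem isUnit_det_of_isLowerTriangular {n : ℕ} {G : Matrix (Fin n) (Fin n) ℝ}
    (hG : IsLMatrix G) (hlow : G.IsLowerTriangular) : IsUnit G.det := by
  rw [Matrix.det_of_isLowerTriangular G hlow, isUnit_iff_ne_zero]
  exact Finset.prod_ne_zero_iff.2 fun i _ => (hG.2 i).ne'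

open Matrix in
/-- A lower triangular L-matrix is monotone. -/
theorem nonneg_of_mulVec_nonneg {n : ℕ} {G : Matrix (Fin n) (Fin n) ℝ}
    (hG : IsLMatrix G) (hlow : G.IsLowerTriangular) {y : Fin n → ℝ}
    (hy : ∀ i, 0 ≤ (G *ᵥ y) i) (i : Fin n) : 0 ≤ y i := by
  induction i using WellFoundedLT.induction with
  | ind i ih =>
    have h1 : (G *ᵥ y) i = G i i * y i + ∑ j ∈ Finset.univ.erase i, G i j * y j :=
      (Finset.add_sum_erase _ (fun j => G i j * y j) (Finset.mem_univ i)).symm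
    have h2 : ∑ j ∈ Finset.univ.erase i, G i j * y j ≤ 0 := by
      refine Finset.sum_nonpos fun j hj => ?_
      rcases lt_or_gt_of_ne (Finset.ne_of_mem_erase hj) with h | h
      · exact mul_nonpos_of_nonpos_of_nonneg (hG.1 i j h.ne') (ih j h)
      · rw [hlow h, zero_mul]
    have h3 : 0 ≤ G i i * y i := by linarith [hy i]
    exact nonneg_of_mul_nonneg_right h3 (hG.2 i)

open Matrix in
theorem inv_nonneg_of_isLowerTriangular {n : ℕ} {G : Matrix (Fin n) (Fin n) ℝ}
    (hG : IsLMatrix G) (hlow : G.IsLowerTriangular) (i j : Fin n) : 0 ≤ G⁻¹ i j := by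
  refine nonneg_of_mulVec_nonneg hG hlow (y := fun i => G⁻¹ i j) (fun k => ?_) i
  have : (G *ᵥ fun i => G⁻¹ i j) k = (1 : Matrix (Fin n) (Fin n) ℝ) k j := by
    rw [← Matrix.mul_nonsing_inv G (isUnit_det_of_isLowerTriangular hG hlow)]; rfl
  rw [this, Matrix.one_apply]
  split_ifs <;> norm_num

/-! ### Perron pairs of AOR matrices -/

section Splitting

variable {n : ℕ} {B : Matrix (Fin n) (Fin n) ℝ} {γ ω : ℝ}

theorem isUnit_det_aorLeft (hB : IsLMatrix B) (hγ0 : 0 ≤ γ) : IsUnit (aorLeft B γ).det :=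
  isUnit_det_of_isLowerTriangular (isLMatrix_aorLeft hB hγ0) (isLowerTriangular_aorLeft B γ)

theorem aorLeft_inv_nonneg (hB : IsLMatrix B) (hγ0 : 0 ≤ γ) (i j : Fin n) :
    0 ≤ (aorLeft B γ)⁻¹ i j :=
  inv_nonneg_of_isLowerTriangular (isLMatrix_aorLeft hB hγ0) (isLowerTriangular_aorLeft B γ) i j

theorem aorLeft_sub_nonneg (hB : IsLMatrix B) (hγ1 : γ ≤ 1) (i j : Fin n) :
    0 ≤ (aorLeft B γ - B) i j := by
  rw [Matrix.sub_apply, aorLeft_apply]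
  by_cases h : i = j
  · subst h; simp
  · nlinarith [hB.1 i j h, aorWeight_le_one hγ1 i j]

/-- The AOR matrix is a convex combination of the identity and of the AOR matrix with `ω = 1`. -/
theorem aorMatrix_eq_add (hB : IsLMatrix B) (hγ0 : 0 ≤ γ) :
    aorMatrix B γ ω = (1 - ω) • 1 + ω • ((aorLeft B γ)⁻¹ * (aorLeft B γ - B)) := by
  rw [aorMatrix_eq, Matrix.mul_sub, Matrix.mul_sub, Matrix.mul_smul,
    Matrix.nonsing_inv_mul _ (isUnit_det_aorLeft hB hγ0), smul_sub, sub_smul, one_smul]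
  abel

theorem aorMatrix_nonneg (hB : IsLMatrix B) (hω0 : 0 < ω) (hω1 : ω ≤ 1) (hγ0 : 0 ≤ γ)
    (hγ1 : γ ≤ 1) (i j : Fin n) : 0 ≤ aorMatrix B γ ω i j := by
  rw [aorMatrix_eq_add hB hγ0]
  refine add_nonneg (mul_nonneg (by linarith) ?_) (mul_nonneg hω0.le ?_)
  · rw [Matrix.one_apply]; split_ifs <;> norm_num
  · rw [Matrix.mul_apply]
    exact Finset.sum_nonneg fun k _ =>
      mul_nonneg (aorLeft_inv_nonneg hB hγ0 i k) (aorLeft_sub_nonneg hB hγ1 k j)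

/-- Off the diagonal, `ωB - (1 - τ)G` therefore has the signs and the zero pattern of `B`; this is
where `τ > 1 - ω` is needed. -/
theorem sub_mul_aorWeight_pos {τ : ℝ} (hω0 : 0 < ω) (hγ0 : 0 ≤ γ) (hγ1 : γ ≤ 1)
    (hτ : 1 - ω < τ) (i j : Fin n) : 0 < ω - (1 - τ) * aorWeight γ i j := by
  have h0 := aorWeight_nonneg hγ0 i j
  have h1 := aorWeight_le_one hγ1 i j
  rcases le_total τ 1 with h | h <;> nlinarith

open Matrix in
theorem smul_mulVec_of_aorMatrix_mulVec (hB : IsLMatrix B) (hγ0 : 0 ≤ γ) {τ : ℝ} {x : Fin n → ℝ}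
    (h : aorMatrix B γ ω *ᵥ x = τ • x) : ω • (B *ᵥ x) = (1 - τ) • (aorLeft B γ *ᵥ x) := by
  have h1 := congrArg (aorLeft B γ *ᵥ ·) h
  simp only [aorMatrix_eq, Matrix.mulVec_mulVec, Matrix.mulVec_smul] at h1
  rw [Matrix.mul_nonsing_inv_cancel_left _ _ (isUnit_det_aorLeft hB hγ0), Matrix.sub_mulVec,
    Matrix.smul_mulVec] at h1
  rw [sub_smul, one_smul, ← h1]
  abel

-- The substitution `q = yG⁻¹` clears the inverse on the left, so that `q` can be paired directly
-- with `B`.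
open Matrix in
theorem smul_vecMul_of_vecMul_aorMatrix (hB : IsLMatrix B) (hγ0 : 0 ≤ γ) {τ : ℝ}
    {y q : Fin n → ℝ} (h : y ᵥ* aorMatrix B γ ω = τ • y) (hq : q = y ᵥ* (aorLeft B γ)⁻¹) :
    q ᵥ* aorLeft B γ = y ∧ ω • (q ᵥ* B) = (1 - τ) • (q ᵥ* aorLeft B γ) := by
  have h0 : q ᵥ* aorLeft B γ = y := by
    rw [hq, Matrix.vecMul_vecMul, Matrix.nonsing_inv_mul _ (isUnit_det_aorLeft hB hγ0),
      Matrix.vecMul_one]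
  refine ⟨h0, ?_⟩
  rw [aorMatrix_eq, ← Matrix.vecMul_vecMul, ← hq, Matrix.vecMul_sub, Matrix.vecMul_smul, h0] at h
  rw [h0, sub_smul, one_smul, ← h]
  abel

open Matrix in
/-- A nonnegative eigenvector of the AOR matrix of an irreducible L-matrix is positive. -/
theorem pos_of_aorMatrix_mulVec (hB : IsLMatrix B) (hirr : IsIrreducibleMatrix B) (hω0 : 0 < ω)
    (hγ0 : 0 ≤ γ) (hγ1 : γ ≤ 1) {τ : ℝ} (hτ : 1 - ω < τ) {x : Fin n → ℝ} (hx : ∀ i, 0 ≤ x i)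
    (hx0 : x ≠ 0) (h : ω • (B *ᵥ x) = (1 - τ) • (aorLeft B γ *ᵥ x)) (i : Fin n) : 0 < x i := by
  by_contra hi
  have hi0 : x i = 0 := le_antisymm (not_lt.1 hi) (hx i)
  -- The zero set of `x` is closed: at an index `a` in it, row `a` of the eigenvalue equation is a
  -- vanishing sum of nonpositive terms.
  refine hx0 (funext fun k => hirr.mem_of_closed (K := {k | x k = 0}) ⟨i, hi0⟩ ?_ k)
  intro a (ha : x a = 0) b hab
  have hsum : ∑ j, (ω - (1 - τ) * aorWeight γ a j) * B a j * x j = 0 := by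
    have h1 := congrFun h a
    simp only [Pi.smul_apply, smul_eq_mul, Matrix.mulVec, dotProduct, aorLeft_apply,
      Finset.mul_sum] at h1
    rw [← sub_eq_zero, ← Finset.sum_sub_distrib] at h1
    rw [← h1]
    exact Finset.sum_congr rfl fun j _ => by ring
  have hle : ∀ j ∈ Finset.univ, (ω - (1 - τ) * aorWeight γ a j) * B a j * x j ≤ 0 := by
    intro j _
    by_cases haj : a = j
    · rw [← haj, ha, mul_zero]
    · exact mul_nonpos_of_nonpos_of_nonneg (mul_nonpos_of_nonneg_of_nonpos
        (sub_mul_aorWeight_pos hω0 hγ0 hγ1 hτ a j).le (hB.1 a j haj)) (hx j)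
  have := (Finset.sum_eq_zero_iff_of_nonpos hle).1 hsum b (Finset.mem_univ b)
  simpa [hab, (sub_mul_aorWeight_pos hω0 hγ0 hγ1 hτ a b).ne'] using this

open Matrix in
/-- The support of a left eigenvector is closed under the nonzero entries of the matrix. -/
theorem pos_of_smul_vecMul (hB : IsLMatrix B) (hω0 : 0 < ω)
    (hγ0 : 0 ≤ γ) (hγ1 : γ ≤ 1) {τ : ℝ} (hτ : 1 - ω < τ) {q : Fin n → ℝ} (hq : ∀ i, 0 ≤ q i)
    (h : ω • (q ᵥ* B) = (1 - τ) • (q ᵥ* aorLeft B γ)) {a b : Fin n} (ha : 0 < q a)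
    (hab : B a b ≠ 0) : 0 < q b := by
  by_contra hb
  have hb0 : q b = 0 := le_antisymm (not_lt.1 hb) (hq b)
  have hsum : ∑ i, q i * ((ω - (1 - τ) * aorWeight γ i b) * B i b) = 0 := by
    have h1 := congrFun h b
    simp only [Pi.smul_apply, smul_eq_mul, Matrix.vecMul, dotProduct, aorLeft_apply,
      Finset.mul_sum] at h1
    rw [← sub_eq_zero, ← Finset.sum_sub_distrib] at h1
    rw [← h1]
    exact Finset.sum_congr rfl fun j _ => by ring
  have hle : ∀ i ∈ Finset.univ, q i * ((ω - (1 - τ) * aorWeight γ i b) * B i b) ≤ 0 := by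
    intro i _
    by_cases hib : i = b
    · rw [hib, hb0, zero_mul]
    · exact mul_nonpos_of_nonneg_of_nonpos (hq i) (mul_nonpos_of_nonneg_of_nonpos
        (sub_mul_aorWeight_pos hω0 hγ0 hγ1 hτ i b).le (hB.1 i b hib))
  have := (Finset.sum_eq_zero_iff_of_nonpos hle).1 hsum a (Finset.mem_univ a)
  simp [hab, (sub_mul_aorWeight_pos hω0 hγ0 hγ1 hτ a b).ne', ha.ne'] at this

open Matrix in
/-- Each row of the AOR matrix of an irreducible L-matrix exceeds that of `(1 - ω) I`. -/
theorem lt_aorMatrix_mulVec_one [Nontrivial (Fin n)] (hB : IsLMatrix B)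
    (hirr : IsIrreducibleMatrix B) (hω0 : 0 < ω) (hγ0 : 0 ≤ γ) (hγ1 : γ ≤ 1) (i : Fin n) :
    1 - ω < (aorMatrix B γ ω *ᵥ 1) i := by
  set z : Fin n → ℝ := (aorLeft B γ)⁻¹ *ᵥ ((aorLeft B γ - B) *ᵥ 1) with hz
  have hMz : aorLeft B γ *ᵥ z = (aorLeft B γ - B) *ᵥ 1 := by
    rw [hz, Matrix.mulVec_mulVec, Matrix.mul_nonsing_inv _ (isUnit_det_aorLeft hB hγ0),
      Matrix.one_mulVec]
  have hz0 : ∀ i, 0 ≤ z i := by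
    intro i
    simp only [hz, Matrix.mulVec, dotProduct]
    exact Finset.sum_nonneg fun j _ =>
      mul_nonneg (aorLeft_inv_nonneg hB hγ0 i j) (Finset.sum_nonneg fun k _ =>
        mul_nonneg (aorLeft_sub_nonneg hB hγ1 j k) zero_le_one)
  -- If `z i = 0`, every term of row `i` of `Gz = (G - B)1` vanishes. A nonzero off-diagonal `B i j`
  -- must then have weight one, so `j < i`, and `z j = 0` contradicts the induction hypothesis.
  have hzpos : ∀ i, 0 < z i := by
    intro i
    induction i using WellFoundedLT.induction with
    | ind i ih =>
      by_contra hi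
      have hi0 : z i = 0 := le_antisymm (not_lt.1 hi) (hz0 i)
      have hsum : ∑ j, ((aorLeft B γ - B) i j + -(aorWeight γ i j * B i j * z j)) = 0 := by
        have h1 := congrFun hMz i
        simp only [Matrix.mulVec, dotProduct, aorLeft_apply, Pi.one_apply, mul_one] at h1
        rw [Finset.sum_add_distrib, ← h1, Finset.sum_neg_distrib, add_neg_cancel]
      have hterm : ∀ j, 0 ≤ -(aorWeight γ i j * B i j * z j) := by
        intro j
        by_cases hij : i = j
        · rw [← hij, hi0]; simp
        · exact neg_nonneg.2 (mul_nonpos_of_nonpos_of_nonneg (mul_nonpos_of_nonneg_of_nonpos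
            (aorWeight_nonneg hγ0 i j) (hB.1 i j hij)) (hz0 j))
      obtain ⟨j, hji, hj⟩ := hirr.exists_ne_zero i
      have hBneg : B i j < 0 := lt_of_le_of_ne (hB.1 i j hji.symm) hj
      have h0 := (Finset.sum_eq_zero_iff_of_nonneg (fun j _ =>
        add_nonneg (aorLeft_sub_nonneg hB hγ1 i j) (hterm j))).1 hsum j (Finset.mem_univ j)
      have h1 : (aorLeft B γ - B) i j = 0 := by
        linarith [aorLeft_sub_nonneg hB hγ1 i j, hterm j]
      have h2 : aorWeight γ i j * B i j * z j = 0 := by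
        linarith [aorLeft_sub_nonneg hB hγ1 i j, hterm j]
      have hw : aorWeight γ i j = 1 := by
        rw [Matrix.sub_apply, aorLeft_apply] at h1
        have : (aorWeight γ i j - 1) * B i j = 0 := by linarith
        rcases mul_eq_zero.1 this with h | h
        · linarith
        · exact absurd h hj
      have hlt : j < i := by
        rcases lt_or_gt_of_ne hji with h | h
        · exact h
        · rw [aorWeight_of_lt γ h] at hw; norm_num at hw
      rw [hw, one_mul] at h2
      exact (mul_neg_of_neg_of_pos hBneg (ih j hlt)).ne h2
  have : (aorMatrix B γ ω *ᵥ 1) i = (1 - ω) + ω * z i := by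
    rw [aorMatrix_eq_add hB hγ0, Matrix.add_mulVec, Matrix.smul_mulVec, Matrix.smul_mulVec,
      Matrix.one_mulVec, ← Matrix.mulVec_mulVec]
    simp [hz]
  rw [this]
  have := mul_pos hω0 (hzpos i)
  linarith

open Matrix in
/-- The Perron pair of the AOR matrix of an irreducible L-matrix. -/
theorem exists_pos_eigenvector_aorMatrix [NeZero n] [Nontrivial (Fin n)] (hB : IsLMatrix B)
    (hirr : IsIrreducibleMatrix B) (hω0 : 0 < ω) (hω1 : ω ≤ 1) (hγ0 : 0 ≤ γ) (hγ1 : γ ≤ 1) :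
    ∃ (τ : ℝ) (x : Fin n → ℝ), 0 ≤ τ ∧ 1 - ω < τ ∧ (∀ i, 0 < x i) ∧
      ω • (B *ᵥ x) = (1 - τ) • (aorLeft B γ *ᵥ x) ∧
      specRadius (aorMatrix B γ ω) = ENNReal.ofReal τ := by
  obtain ⟨τ, x, hτ0, hx, hx0, hτx, hspec, hmax⟩ :=
    exists_eigenvector_specRadius (aorMatrix_nonneg hB hω0 hω1 hγ0 hγ1)
  have hτ : 1 - ω < τ := by
    -- The smallest row sum is a Collatz–Wielandt bound for the all-ones vector.
    obtain ⟨k, -, hk⟩ := Finset.exists_min_image Finset.univ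
      (fun i => (aorMatrix B γ ω *ᵥ 1) i) ⟨0, Finset.mem_univ _⟩
    refine (lt_aorMatrix_mulVec_one hB hirr hω0 hγ0 hγ1 k).trans_le
      (hmax _ 1 (fun _ => zero_le_one) one_ne_zero fun i => ?_)
    simpa using hk i (Finset.mem_univ i)
  have h := smul_mulVec_of_aorMatrix_mulVec hB hγ0 hτx
  exact ⟨τ, x, hτ0, hτ, pos_of_aorMatrix_mulVec hB hirr hω0 hγ0 hγ1 hτ hx hx0 h, h, hspec⟩

open Matrix in
/-- A left Perron pair of the AOR matrix of an L-matrix, in terms of the splitting. -/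
theorem exists_left_eigenvector_aorMatrix [NeZero n] (hB : IsLMatrix B)
    (hω0 : 0 < ω) (hω1 : ω ≤ 1) (hγ0 : 0 ≤ γ) (hγ1 : γ ≤ 1) :
    ∃ (τ : ℝ) (q : Fin n → ℝ), 0 ≤ τ ∧ (∀ i, 0 ≤ q i) ∧ (∀ i, 0 ≤ (q ᵥ* aorLeft B γ) i) ∧
      q ᵥ* aorLeft B γ ≠ 0 ∧ ω • (q ᵥ* B) = (1 - τ) • (q ᵥ* aorLeft B γ) ∧
      specRadius (aorMatrix B γ ω) = ENNReal.ofReal τ := by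
  obtain ⟨τ, y, hτ0, hy, hy0, hτy, hspec, -⟩ := exists_eigenvector_specRadius
    (T := (aorMatrix B γ ω)ᵀ) fun i j => aorMatrix_nonneg hB hω0 hω1 hγ0 hγ1 j i
  rw [Matrix.mulVec_transpose] at hτy
  obtain ⟨h1, h2⟩ := smul_vecMul_of_vecMul_aorMatrix hB hγ0 hτy rfl
  refine ⟨τ, y ᵥ* (aorLeft B γ)⁻¹, hτ0, fun i => ?_, ?_, ?_, h2, ?_⟩
  · simp only [Matrix.vecMul, dotProduct]
    exact Finset.sum_nonneg fun j _ => mul_nonneg (hy j) (aorLeft_inv_nonneg hB hγ0 j i)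
  · rwa [h1]
  · rwa [h1]
  · rw [← hspec, specRadius_transpose]

end Splitting

/-! ### The preconditioned matrix and the splitting defect -/

section Preconditioner

variable {n : ℕ} {A α : Matrix (Fin n) (Fin n) ℝ} {γ ω : ℝ}

theorem preconditioned_apply (A α : Matrix (Fin n) (Fin n) ℝ) (i j : Fin n) :
    preconditioned A α i j = A i j - ∑ k ∈ Finset.Iio i, α i k * A i k * A k j := by
  rw [preconditioned, Matrix.add_mul, Matrix.one_mul, Matrix.add_apply, Matrix.mul_apply,
    sub_eq_add_neg, ← Finset.sum_neg_distrib]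
  congr 1
  rw [← Finset.sum_subset (Finset.subset_univ (Finset.Iio i))]
  · exact Finset.sum_congr rfl fun k hk => by simp [lowerQ, Finset.mem_Iio.1 hk]
  · intro k _ hk
    simp [lowerQ, Finset.mem_Iio.not.1 hk]

theorem preconditioned_eq_lowerExpr (hdiag : ∀ i, A i i = 1) {i j : Fin n} (h : j < i) :
    preconditioned A α i j = lowerExpr A α i j := by
  rw [preconditioned_apply, lowerExpr, ← Finset.add_sum_erase _ _ (Finset.mem_Iio.2 h), hdiag j]
  ring

theorem lowerQ_nonneg (hL : IsLMatrix A) (hα : ∀ i j, j < i → 0 ≤ α i j) (i j : Fin n) :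
    0 ≤ lowerQ A α i j := by
  by_cases h : j < i
  · simpa [lowerQ, h] using mul_nonpos_of_nonneg_of_nonpos (hα i j h) (hL.1 i j h.ne')
  · simp [lowerQ, h]

theorem preconditioned_le_of_lt (hL : IsLMatrix A) (hα : ∀ i j, j < i → 0 ≤ α i j) {i j : Fin n}
    (h : i < j) : preconditioned A α i j ≤ A i j := by
  rw [preconditioned_apply, sub_le_self_iff]
  refine Finset.sum_nonneg fun k hk => mul_nonneg_of_nonpos_of_nonpos ?_ ?_
  · have hk := Finset.mem_Iio.1 hk
    exact mul_nonpos_of_nonneg_of_nonpos (hα i k hk) (hL.1 i k hk.ne')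
  · exact hL.1 k j ((Finset.mem_Iio.1 hk).trans h).ne

theorem isLMatrix_preconditioned (hdiag : ∀ i, A i i = 1) (hL : IsLMatrix A)
    (hα : ∀ i j, j < i → 0 ≤ α i j) (hsum : ∀ i, ∑ k ∈ Finset.Iio i, α i k * A i k * A k i < 1)
    (he : ∀ i j, j < i → lowerExpr A α i j ≤ 0) : IsLMatrix (preconditioned A α) := by
  refine ⟨fun i j hij => ?_, fun i => ?_⟩
  · rcases lt_or_gt_of_ne hij with h | h
    · exact (preconditioned_le_of_lt hL hα h).trans (hL.1 i j hij)
    · rw [preconditioned_eq_lowerExpr hdiag h]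
      exact he i j h
  · rw [preconditioned_apply, hdiag]
    linarith [hsum i]

/-- This is why the sign condition need only be imposed where `A i j < 0`. -/
theorem lowerExpr_nonpos_of_eq_zero (hL : IsLMatrix A) (hα : ∀ i j, j < i → 0 ≤ α i j)
    {i j : Fin n} (h : A i j = 0) : lowerExpr A α i j ≤ 0 := by
  rw [lowerExpr, h, mul_zero, zero_sub, neg_nonpos]
  refine Finset.sum_nonneg fun k hk => ?_
  have hki := Finset.mem_Iio.1 (Finset.mem_of_mem_erase hk)
  exact mul_nonneg_of_nonpos_of_nonpos (mul_nonpos_of_nonneg_of_nonpos (hα i k hki)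
    (hL.1 i k hki.ne')) (hL.1 k j (Finset.ne_of_mem_erase hk))

/-- The defect `P (D - γ L) - (D' - γ L')` of the splittings of `A` and of `A' = P A`. -/
noncomputable def splittingDefect (A α : Matrix (Fin n) (Fin n) ℝ) (γ : ℝ) :
    Matrix (Fin n) (Fin n) ℝ :=
  (1 + lowerQ A α) * aorLeft A γ - aorLeft (preconditioned A α) γ

theorem splittingDefect_apply (A α : Matrix (Fin n) (Fin n) ℝ) (γ : ℝ) (i j : Fin n) :
    splittingDefect A α γ i j =
      ∑ k, lowerQ A α i k * ((aorWeight γ k j - aorWeight γ i j) * A k j) := by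
  simp only [splittingDefect, preconditioned, Matrix.sub_apply, aorLeft_apply, Matrix.add_mul,
    Matrix.one_mul, Matrix.add_apply, Matrix.mul_apply, mul_add, Finset.mul_sum]
  rw [add_sub_add_left_eq_sub, ← Finset.sum_sub_distrib]
  exact Finset.sum_congr rfl fun k _ => by ring

/-- Entries of `A` below the diagonal cancel, since both weights equal `γ`. The diagonal entry `k =
j` contributes `1 - γ`, and entries above the diagonal contribute `-A k j` times a nonnegative
weight. -/
theorem splittingDefect_term_nonneg (hdiag : ∀ i, A i i = 1) (hL : IsLMatrix A)
    (hα : ∀ i j, j < i → 0 ≤ α i j) (hγ0 : 0 ≤ γ) (hγ1 : γ ≤ 1) (i j k : Fin n) :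
    0 ≤ lowerQ A α i k * ((aorWeight γ k j - aorWeight γ i j) * A k j) := by
  by_cases hki : k < i
  · refine mul_nonneg (lowerQ_nonneg hL hα i k) ?_
    rcases lt_trichotomy k j with h | rfl | h
    · rw [aorWeight_of_lt γ h]
      nlinarith [aorWeight_nonneg hγ0 i j, hL.1 k j h.ne]
    · rw [aorWeight_self, hdiag, aorWeight_of_gt γ hki]
      linarith
    · rw [aorWeight_of_gt γ h, aorWeight_of_gt γ (h.trans hki)]
      simp
  · simp [lowerQ, hki]

theorem splittingDefect_nonneg (hdiag : ∀ i, A i i = 1) (hL : IsLMatrix A)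
    (hα : ∀ i j, j < i → 0 ≤ α i j) (hγ0 : 0 ≤ γ) (hγ1 : γ ≤ 1) (i j : Fin n) :
    0 ≤ splittingDefect A α γ i j := by
  rw [splittingDefect_apply]
  exact Finset.sum_nonneg fun k _ => splittingDefect_term_nonneg hdiag hL hα hγ0 hγ1 i j k

theorem splittingDefect_pos_of_lt_one (hdiag : ∀ i, A i i = 1) (hL : IsLMatrix A)
    (hα : ∀ i j, j < i → 0 ≤ α i j) (hγ0 : 0 ≤ γ) (hγ1 : γ < 1) {i k : Fin n} (hki : k < i)
    (h : α i k * A i k < 0) : 0 < splittingDefect A α γ i k := by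
  rw [splittingDefect_apply]
  refine Finset.sum_pos' (fun l _ => splittingDefect_term_nonneg hdiag hL hα hγ0 hγ1.le i k l)
    ⟨k, Finset.mem_univ k, ?_⟩
  rw [aorWeight_self, hdiag, aorWeight_of_gt γ hki, mul_one]
  refine mul_pos ?_ (sub_pos.2 hγ1)
  simpa [lowerQ, hki] using h

/-- For `γ = 1` the diagonal contribution disappears, so a positive entry must come from an entry of
`A` above the diagonal. -/
theorem splittingDefect_one_pos (hdiag : ∀ i, A i i = 1) (hL : IsLMatrix A)
    (hα : ∀ i j, j < i → 0 ≤ α i j) {i j k : Fin n} (hkj : k < j) (hji : j ≤ i)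
    (h : 0 < α i k * A i k * A k j) : 0 < splittingDefect A α 1 i j := by
  rw [splittingDefect_apply]
  refine Finset.sum_pos' (fun l _ =>
    splittingDefect_term_nonneg hdiag hL hα zero_le_one le_rfl i j l) ⟨k, Finset.mem_univ k, ?_⟩
  have hw : aorWeight (1 : ℝ) i j = 1 := by
    rcases hji.lt_or_eq with h | rfl
    · exact aorWeight_of_gt 1 h
    · exact aorWeight_self 1 j
  rw [aorWeight_of_lt 1 hkj, hw]
  simp only [lowerQ, Matrix.of_apply, if_pos (hkj.trans_le hji)]
  linarith

open Matrix in
/-- Comparison of the AOR iteration matrices of `A` and of the preconditioned matrix, given that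
each nonempty set of indices closed under the nonzero entries of the latter meets a nonzero row of
the defect. -/
theorem steinRosenbergStrict_of_splittingDefect [NeZero n] [Nontrivial (Fin n)]
    (hω0 : 0 < ω) (hω1 : ω ≤ 1) (hγ0 : 0 ≤ γ) (hγ1 : γ ≤ 1)
    (hdiag : ∀ i, A i i = 1) (hL : IsLMatrix A) (hirr : IsIrreducibleMatrix A)
    (hα : ∀ i j, j < i → 0 ≤ α i j) (hL' : IsLMatrix (preconditioned A α))
    (hF : ∀ K : Set (Fin n), K.Nonempty →
      (∀ i ∈ K, ∀ j, preconditioned A α i j ≠ 0 → j ∈ K) →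
      ∃ i ∈ K, ∃ j, 0 < splittingDefect A α γ i j) :
    SteinRosenbergStrict (specRadius (aorMatrix (preconditioned A α) γ ω))
      (specRadius (aorMatrix A γ ω)) := by
  obtain ⟨τ, x, hτ0, hτ, hx, hAx, hspec⟩ :=
    exists_pos_eigenvector_aorMatrix hL hirr hω0 hω1 hγ0 hγ1
  obtain ⟨τ', q, hτ'0, hq, hy, hy0, hqA, hspec'⟩ :=
    exists_left_eigenvector_aorMatrix hL' hω0 hω1 hγ0 hγ1
  set F := splittingDefect A α γ with hFdef
  have hFn := splittingDefect_nonneg hdiag hL hα hγ0 hγ1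
  set Y : ℝ := (q ᵥ* aorLeft (preconditioned A α) γ) ⬝ᵥ x with hY
  set Z : ℝ := q ⬝ᵥ (F *ᵥ x) with hZ
  have hYpos : 0 < Y := by
    obtain ⟨i, hi⟩ := Function.ne_iff.1 hy0
    exact Finset.sum_pos' (fun i _ => mul_nonneg (hy i) (hx i).le)
      ⟨i, Finset.mem_univ i, mul_pos (lt_of_le_of_ne (hy i) (Ne.symm hi)) (hx i)⟩
  have hFx : ∀ i, 0 ≤ (F *ᵥ x) i := fun i => by
    simp only [Matrix.mulVec, dotProduct]
    exact Finset.sum_nonneg fun j _ => mul_nonneg (hFn i j) (hx j).le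
  have hZ0 : 0 ≤ Z := Finset.sum_nonneg fun i _ => mul_nonneg (hq i) (hFx i)
  -- Both sides equal `ω qA'x`, computed from the left pair of `A'` and from the right pair of `A`.
  have key : (1 - τ') * Y = (1 - τ) * (Y + Z) := by
    have h1 : (1 - τ') * Y = ω * (q ⬝ᵥ (preconditioned A α *ᵥ x)) := by
      rw [Matrix.dotProduct_mulVec, hY, ← smul_eq_mul, ← smul_eq_mul, ← smul_dotProduct,
        ← smul_dotProduct, hqA]
    have h2 : ω • (preconditioned A α *ᵥ x) =
        (1 - τ) • (((1 + lowerQ A α) * aorLeft A γ) *ᵥ x) := by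
      rw [preconditioned, ← Matrix.mulVec_mulVec, ← Matrix.mulVec_smul, hAx, Matrix.mulVec_smul,
        Matrix.mulVec_mulVec]
    have h3 : (1 + lowerQ A α) * aorLeft A γ = aorLeft (preconditioned A α) γ + F := by
      rw [hFdef, splittingDefect]; abel
    rw [h1, ← smul_eq_mul, ← dotProduct_smul, h2, h3, Matrix.add_mulVec, dotProduct_smul,
      dotProduct_add, Matrix.dotProduct_mulVec, smul_eq_mul]
  have hZpos : 1 - ω < τ' → 0 < Z := by
    intro hτ'
    have hq0 : ∃ i, 0 < q i := by
      by_contra! h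
      refine hy0 ?_
      have : q = 0 := funext fun i => le_antisymm (h i) (hq i)
      rw [this, Matrix.zero_vecMul]
    obtain ⟨i, hi, j, hij⟩ := hF {i | 0 < q i} hq0 fun a ha b hab =>
      pos_of_smul_vecMul hL' hω0 hγ0 hγ1 hτ' hq hqA ha hab
    refine Finset.sum_pos' (fun i _ => mul_nonneg (hq i) (hFx i))
      ⟨i, Finset.mem_univ i, mul_pos hi ?_⟩
    simp only [Matrix.mulVec, dotProduct]
    exact Finset.sum_pos' (fun j _ => mul_nonneg (hFn i j) (hx j).le)
      ⟨j, Finset.mem_univ j, mul_pos hij (hx j)⟩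
  -- For `τ ≠ 1`, strictness needs `Z > 0`, which is only available when `τ' > 1 - ω`. This follows
  -- from `τ ≤ τ'`, which is assumed for contradiction when `τ < 1` and is a consequence of `Z ≥ 0`
  -- when `τ > 1`.
  have hreal : (τ' < τ ∧ τ < 1) ∨ (τ' = τ ∧ τ = 1) ∨ (τ < τ' ∧ 1 < τ) := by
    have key' : (τ - τ') * Y = (1 - τ) * Z := by linarith
    rcases lt_trichotomy τ 1 with h | h | h
    · refine Or.inl ⟨?_, h⟩
      by_contra! hle
      have := hZpos (hτ.trans_le hle)
      nlinarith
    · refine Or.inr (Or.inl ⟨?_, h⟩)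
      rw [h, sub_self, zero_mul] at key'
      have := (mul_eq_zero.1 key').resolve_right hYpos.ne'
      linarith
    · refine Or.inr (Or.inr ⟨?_, h⟩)
      have hle : τ ≤ τ' := by
        by_contra! hlt
        nlinarith
      have := hZpos (hτ.trans_le hle)
      by_contra! hle'
      nlinarith
  rw [hspec, hspec']
  refine ⟨?_, fun h => h.1.2.ne h.2.2, fun h => lt_asymm h.1.2 h.2.2, fun h => h.2.2.ne' h.1.2⟩
  rcases hreal with ⟨h1, h2⟩ | ⟨h1, h2⟩ | ⟨h1, h2⟩
  · refine Or.inl ⟨(ENNReal.ofReal_lt_ofReal_iff (hτ'0.trans_lt h1)).2 h1, ?_⟩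
    rwa [ENNReal.ofReal_lt_one]
  · exact Or.inr (Or.inl ⟨by rw [h1], by rw [h2, ENNReal.ofReal_one]⟩)
  · refine Or.inr (Or.inr ⟨(ENNReal.ofReal_lt_ofReal_iff (hτ0.trans_lt h1)).2 h1, ?_⟩)
    rwa [gt_iff_lt, ENNReal.one_lt_ofReal]

/-- The condition on the lower part forces the preconditioned matrix to be irreducible. -/
theorem isIrreducibleMatrix_preconditioned (hdiag : ∀ i, A i i = 1) (hL : IsLMatrix A)
    (hirr : IsIrreducibleMatrix A) (hα : ∀ i j, j < i → 0 ≤ α i j)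
    (h : ∀ i j, j < i → A i j < 0 → LesssimZero (preconditioned A α) (lowerExpr A α i j)) :
    IsIrreducibleMatrix (preconditioned A α) := by
  by_contra hred
  -- Were `A'` reducible, the condition would be strict, so every nonzero off-diagonal entry of `A`
  -- would survive in `A'`, making it irreducible.
  refine hred (hirr.mono fun i j hij h0 => ?_)
  by_contra hA
  have hneg : A i j < 0 := lt_of_le_of_ne (hL.1 i j hij) hA
  rcases lt_or_gt_of_ne hij with hlt | hlt
  · exact ((preconditioned_le_of_lt hL hα hlt).trans_lt hneg).ne h0
  · rw [preconditioned_eq_lowerExpr hdiag hlt] at h0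
    exact ((h i j hlt hneg).2 hred).ne h0

theorem lowerExpr_nonpos_of_lesssimZero (hL : IsLMatrix A) (hα : ∀ i j, j < i → 0 ≤ α i j)
    (h : ∀ i j, j < i → A i j < 0 → LesssimZero (preconditioned A α) (lowerExpr A α i j))
    (i j : Fin n) (hji : j < i) : lowerExpr A α i j ≤ 0 := by
  rcases (hL.1 i j hji.ne').lt_or_eq with h0 | h0
  · by_cases hirr : IsIrreducibleMatrix (preconditioned A α)
    · exact (h i j hji h0).1 hirr
    · exact ((h i j hji h0).2 hirr).le
  · exact lowerExpr_nonpos_of_eq_zero hL hα h0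

end Preconditioner

/-! ### Positive defect entries under the three sets of hypotheses -/

/-- If the preconditioner uses the corner entry, then the last row of the defect is nonzero. -/
theorem exists_splittingDefect_last_pos {m : ℕ} {A α : Matrix (Fin (m + 1)) (Fin (m + 1)) ℝ}
    [Nontrivial (Fin (m + 1))] (hdiag : ∀ i, A i i = 1) (hL : IsLMatrix A)
    (hirr : IsIrreducibleMatrix A) (hα : ∀ i j, j < i → 0 ≤ α i j) (hA : A (Fin.last m) 0 < 0)
    (hα0 : 0 < α (Fin.last m) 0) : ∃ j, 0 < splittingDefect A α 1 (Fin.last m) j := by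
  obtain ⟨j, hj0, hj⟩ := hirr.exists_ne_zero 0
  have hneg : A 0 j < 0 := lt_of_le_of_ne (hL.1 0 j hj0.symm) hj
  exact ⟨j, splittingDefect_one_pos hdiag hL hα (Fin.pos_iff_ne_zero.2 hj0) (Fin.le_last j)
    (mul_pos_of_neg_of_neg (mul_neg_of_pos_of_neg hα0 hA) hneg)⟩

/-- The matrices have order `m + 1`; the indices `0` and `Fin.last m` are the first and last. -/
theorem theorem3p11 (m : ℕ) (A α : Matrix (Fin (m + 1)) (Fin (m + 1)) ℝ) (γ ω : ℝ)
    (hω0 : 0 < ω) (hω1 : ω ≤ 1) (hγ0 : 0 ≤ γ) (hγ1 : γ ≤ 1)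
    (hdiag : ∀ i, A i i = 1) (hL : IsLMatrix A) (hirr : IsIrreducibleMatrix A)
    (hα : ∀ i j, j < i → 0 ≤ α i j)
    (hQ : ∑ i, ∑ j ∈ Finset.Iio i, α i j * A i j ≠ 0)
    (hsum : ∀ i, ∑ k ∈ Finset.Iio i, α i k * A i k * A k i < 1)
    (hcond :
      -- (i)
      (γ < 1 ∧
        ∀ i j, j < i → A i j < 0 → LesssimZero (preconditioned A α) (lowerExpr A α i j)) ∨
      -- (ii)
      (γ = 1 ∧
        (∀ i j, j < i → A i j < 0 → LesssimZero (preconditioned A α) (lowerExpr A α i j)) ∧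
        ((∃ i j k, 0 < j ∧ j ≤ i ∧ k < j ∧ 0 < α i k * A i k * A k j) ∨
          (A (Fin.last m) 0 < 0 ∧ 0 < α (Fin.last m) 0) ∨
          (∀ k : Fin m, A k.castSucc k.succ < 0))) ∨
      -- (iii)
      (γ = 1 ∧
        (∀ i j, j < i → lowerExpr A α i j ≤ 0) ∧
        (∀ i, 0 < i → i < Fin.last m →
          ∃ j k, 0 < j ∧ j ≤ i ∧ k < j ∧ 0 < α i k * A i k * A k j) ∧
        ((∃ j k, 0 < j ∧ k < j ∧
            0 < α (Fin.last m) k * A (Fin.last m) k * A k j) ∨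
          (A (Fin.last m) 0 < 0 ∧ 0 < α (Fin.last m) 0) ∨
          (∃ j, 0 < j ∧ j < Fin.last m ∧ lowerExpr A α (Fin.last m) j < 0)))) :
    SteinRosenbergStrict (specRadius (aorMatrix (preconditioned A α) γ ω))
      (specRadius (aorMatrix A γ ω)) := by
  obtain ⟨i₀, k₀, hk₀, hQ₀⟩ : ∃ i k, k < i ∧ α i k * A i k < 0 := by
    by_contra! h
    refine hQ (Finset.sum_eq_zero fun i _ => Finset.sum_eq_zero fun k hk => ?_)
    have hk := Finset.mem_Iio.1 hk
    exact le_antisymm (mul_nonpos_of_nonneg_of_nonpos (hα i k hk) (hL.1 i k hk.ne')) (h i k hk)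
  -- Order one is excluded: there the AOR matrix is the scalar `1 - ω`, and the strict bound `1 - ω
  -- < τ` fails.
  have : Nontrivial (Fin (m + 1)) := ⟨i₀, k₀, hk₀.ne'⟩
  -- If the condition on the lower part holds, one nonzero entry of the defect suffices.
  have main : (∀ i j, j < i → A i j < 0 →
      LesssimZero (preconditioned A α) (lowerExpr A α i j)) →
      (∃ i j, 0 < splittingDefect A α γ i j) →
      SteinRosenbergStrict (specRadius (aorMatrix (preconditioned A α) γ ω))
        (specRadius (aorMatrix A γ ω)) := by
    rintro h ⟨i, j, hij⟩
    have hirr' := isIrreducibleMatrix_preconditioned hdiag hL hirr hα h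
    exact steinRosenbergStrict_of_splittingDefect hω0 hω1 hγ0 hγ1 hdiag hL hirr hα
      (isLMatrix_preconditioned hdiag hL hα hsum (lowerExpr_nonpos_of_lesssimZero hL hα h))
      fun K hne hK => ⟨i, hirr'.mem_of_closed hne hK i, j, hij⟩
  rcases hcond with ⟨hγ, h⟩ | ⟨rfl, h, h'⟩ | ⟨rfl, he, hmid, hlast⟩
  · exact main h ⟨i₀, k₀, splittingDefect_pos_of_lt_one hdiag hL hα hγ0 hγ hk₀ hQ₀⟩
  · refine main h ?_
    rcases h' with ⟨i, j, k, -, hji, hkj, hpos⟩ | ⟨hA, hα0⟩ | hsup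
    · exact ⟨i, j, splittingDefect_one_pos hdiag hL hα hkj hji hpos⟩
    · exact ⟨_, exists_splittingDefect_last_pos hdiag hL hirr hα hA hα0⟩
    · have hk₀m : k₀.val < m := by have := i₀.isLt; omega
      -- The column is `k₀ + 1 ≤ i₀`, which pairs the active entry `(i₀, k₀)` with the superdiagonal
      -- entry of row `k₀`.
      refine ⟨i₀, (⟨k₀, hk₀m⟩ : Fin m).succ, splittingDefect_one_pos (k := k₀) hdiag hL hα
        ?_ ?_ (mul_pos_of_neg_of_neg hQ₀ (hsup ⟨k₀, hk₀m⟩))⟩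
      · simp [Fin.lt_def]
      · simpa [Fin.le_def] using Nat.succ_le_of_lt hk₀
  · have hrow : ∀ i, 0 < i → i < Fin.last m → ∃ j, 0 < splittingDefect A α 1 i j := by
      intro i h0 hi
      obtain ⟨j, k, -, hji, hkj, hpos⟩ := hmid i h0 hi
      exact ⟨j, splittingDefect_one_pos hdiag hL hα hkj hji hpos⟩
    refine steinRosenbergStrict_of_splittingDefect hω0 hω1 hγ0 hγ1 hdiag hL hirr hα
      (isLMatrix_preconditioned hdiag hL hα hsum he) fun K hne hK => ?_
    -- Row `0` of the defect is zero, but a closed set containing `0` contains another index: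
    -- entries above the diagonal only decrease under preconditioning, so a negative entry of row
    -- `0` stays nonzero.
    obtain ⟨i, hiK, hi0⟩ : ∃ i ∈ K, i ≠ 0 := by
      obtain ⟨i, hi⟩ := hne
      by_cases h0 : i = 0
      · subst h0
        obtain ⟨j, hj0, hj⟩ := hirr.exists_ne_zero 0
        refine ⟨j, hK 0 hi j ?_, hj0⟩
        exact ((preconditioned_le_of_lt hL hα (Fin.pos_iff_ne_zero.2 hj0)).trans_lt
          (lt_of_le_of_ne (hL.1 0 j hj0.symm) hj)).ne
      · exact ⟨i, hi, h0⟩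
    by_cases hil : i < Fin.last m
    · exact ⟨i, hiK, hrow i (Fin.pos_iff_ne_zero.2 hi0) hil⟩
    · obtain rfl : i = Fin.last m := le_antisymm (Fin.le_last i) (not_lt.1 hil)
      rcases hlast with ⟨j, k, -, hkj, hpos⟩ | ⟨hA, hα0⟩ | ⟨j, hj0, hjl, hj⟩
      · exact ⟨_, hiK, j, splittingDefect_one_pos hdiag hL hα hkj (Fin.le_last j) hpos⟩
      · exact ⟨_, hiK, exists_splittingDefect_last_pos hdiag hL hirr hα hA hα0⟩
      -- Here the last row of the defect may vanish, but `A'` has a nonzero entry from it to a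
      -- middle index `j`, whose row does not.
      · refine ⟨j, hK _ hiK j ?_, hrow j hj0 hjl⟩
        rw [preconditioned_eq_lowerExpr hdiag hjl]
        exact hj.ne
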